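/- Let $a,b,c,u\in\mathbb{C}$ be such that (i) $a\neq 0$ and $u\neq 0$; (ii) $b=r\,i$ for a real number $r$ with $r>1>|c|$; (iii) $c \neq 0$, and the three real numbers $1$, $\dfrac{\ln|c|}{\ln|b|}$, $\dfrac{\arg(c)}{2\pi}$ are linearly independent over $\mathbb{Q}$. Then the multiplicative semigroup generated by the matrices $$C=\begin{pmatrix} c & 0\\ 0 & 1\end{pmatrix},\qquad B=\begin{pmatrix} 1 & 0\\ 0 & b\end{pmatrix},\qquad A=\begin{pmatrix} u & a\\ 1 & 0\end{pmatrix}$$ (the set of all nonempty finite products of these matrices) is dense in the space of all $2\times 2$ complex matrices. -/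

import Mathlib

open Filter Topology UnitAddTorus

/-! In a word `C^m₁ B^n₁ A C^m₂ B^n₂` the off-diagonal entries depend on the disjoint exponent pairs
`(m₁, n₂)` and `(m₂, n₁)`, while the corner carries the factor `c^(m₁ + m₂)`. By Kronecker's theorem
the numbers `c^m b^n` approximate any complex number with `m` arbitrarily large, so the corner dies
and the closure contains every antidiagonal matrix. Their products give all diagonal matrices, `A`
rescaled by these gives triangular ones, and LU factorization gives everything. -/

/-- The Birkhoff averages of a continuous function along the orbits `y, y + x, y + 2x, …`
become independent of the starting point when no nontrivial character is trivial at `x`. -/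
theorem tendsto_average_sub_average {d : Type*} [Fintype d] (x : UnitAddTorus d)
    (hx : ∀ n : d → ℤ, mFourier n x = 1 → n = 0) (y : UnitAddTorus d)
    (f : C(UnitAddTorus d, ℂ)) :
    Tendsto (fun N : ℕ => (N : ℂ)⁻¹ * ∑ k ∈ Finset.range N, (f (y + k • x) - f (k • x)))
      atTop (𝓝 0) := by
  have hadd : ∀ (n : d → ℤ) (s t : UnitAddTorus d),
      mFourier n (s + t) = mFourier n s * mFourier n t := by
    intro n s t
    simp [mFourier, fourier_apply, Finset.prod_mul_distrib, AddCircle.toCircle_add]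
  have hsmul : ∀ (n : d → ℤ) (k : ℕ), mFourier n (k • x) = mFourier n x ^ k := by
    intro n k
    induction k with
    | zero => simp [mFourier]
    | succ k ih => rw [succ_nsmul, hadd, ih, pow_succ]
  have hone : ∀ (n : d → ℤ) (s : UnitAddTorus d), ‖mFourier n s‖ = 1 := by
    intro n s
    simp only [mFourier, fourier_apply, ContinuousMap.coe_mk, norm_prod, Circle.norm_coe,
      Finset.prod_const_one]
  -- For a nontrivial character the sum is geometric, hence bounded; linearity and uniform
  -- approximation do the rest.
  have hclosed : ∀ f ∈ (Submodule.span ℂ (Set.range <| mFourier (d := d))).topologicalClosure,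
      Tendsto (fun N : ℕ => (N : ℂ)⁻¹ * ∑ k ∈ Finset.range N, (f (y + k • x) - f (k • x)))
      atTop (𝓝 0) := by
    intro f hf
    rw [Metric.tendsto_atTop]
    intro ε hε
    obtain ⟨g, hg, hfg⟩ := Metric.mem_closure_iff.1 hf (ε / 4) (by positivity)
    have hgt : Tendsto (fun N : ℕ =>
        (N : ℂ)⁻¹ * ∑ k ∈ Finset.range N, (g (y + k • x) - g (k • x))) atTop (𝓝 0) := by
      refine Submodule.span_induction ?_ ?_ ?_ ?_ hg
      · rintro _ ⟨n, rfl⟩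
        by_cases hn : n = 0
        · subst hn
          simp [mFourier_zero]
        · have h1 : mFourier n x ≠ 1 := fun h => hn (hx n h)
          have h2 : ∀ N : ℕ, ∑ k ∈ Finset.range N, (mFourier n (y + k • x) - mFourier n (k • x))
              = (mFourier n y - 1) * ((mFourier n x ^ N - 1) / (mFourier n x - 1)) := by
            intro N
            rw [← geom_sum_eq h1, Finset.mul_sum]
            exact Finset.sum_congr rfl fun k _ => by rw [hadd, hsmul]; ring
          simp_rw [h2]
          refine squeeze_zero_norm (a := fun N : ℕ =>
            (N : ℝ)⁻¹ * (‖mFourier n y - 1‖ * (2 / ‖mFourier n x - 1‖))) (fun N => ?_) ?_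
          · rw [norm_mul, norm_mul, norm_inv, norm_div, RCLike.norm_natCast]
            have : ‖mFourier n x ^ N - 1‖ ≤ 2 := by
              refine (norm_sub_le _ _).trans ?_
              rw [norm_pow, hone]
              norm_num
            gcongr
          · simpa using (tendsto_inv_atTop_nhds_zero_nat (𝕜 := ℝ)).mul_const
              (‖mFourier n y - 1‖ * (2 / ‖mFourier n x - 1‖))
      · simp
      · intro p q _ _ hp hq
        have := hp.add hq
        rw [add_zero] at this
        refine this.congr fun N => ?_
        rw [← mul_add, ← Finset.sum_add_distrib]
        congr 1
        exact Finset.sum_congr rfl fun k _ => by simp only [ContinuousMap.add_apply]; ring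
      · intro a p _ hp
        have := hp.const_mul a
        rw [mul_zero] at this
        refine this.congr fun N => ?_
        rw [mul_left_comm, Finset.mul_sum]
        congr 1
        exact Finset.sum_congr rfl fun k _ => by
          simp only [ContinuousMap.smul_apply, smul_eq_mul]; ring
    obtain ⟨N₀, hN₀⟩ := Metric.tendsto_atTop.1 hgt (ε / 2) (by positivity)
    refine ⟨N₀, fun N hN => ?_⟩
    have h1 := hN₀ N hN
    rw [dist_zero_right] at h1 ⊢
    have hpt : ∀ s, ‖f s - g s‖ ≤ ε / 4 := fun s => by
      rw [← dist_eq_norm]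
      exact (ContinuousMap.dist_apply_le_dist s).trans hfg.le
    have h2 : ‖(N : ℂ)⁻¹ * ∑ k ∈ Finset.range N,
        ((f (y + k • x) - g (y + k • x)) - (f (k • x) - g (k • x)))‖ ≤ ε / 2 := by
      rw [norm_mul, norm_inv, RCLike.norm_natCast]
      have h3 : ‖∑ k ∈ Finset.range N,
          ((f (y + k • x) - g (y + k • x)) - (f (k • x) - g (k • x)))‖ ≤ N * (ε / 2) := by
        rw [← nsmul_eq_mul]
        nth_rewrite 2 [← Finset.card_range N]
        rw [← Finset.sum_const]
        refine norm_sum_le_of_le _ fun k _ => ?_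
        refine (norm_sub_le _ _).trans ?_
        linarith [hpt (y + k • x), hpt (k • x)]
      rcases Nat.eq_zero_or_pos N with rfl | hpos
      · simp; positivity
      · have : (0 : ℝ) < N := by exact_mod_cast hpos
        rw [inv_mul_le_iff₀ this]
        exact h3
    have h4 : (N : ℂ)⁻¹ * ∑ k ∈ Finset.range N, (f (y + k • x) - f (k • x)) =
        (N : ℂ)⁻¹ * ∑ k ∈ Finset.range N,
          ((f (y + k • x) - g (y + k • x)) - (f (k • x) - g (k • x))) +
        (N : ℂ)⁻¹ * ∑ k ∈ Finset.range N, (g (y + k • x) - g (k • x)) := by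
      rw [← mul_add, ← Finset.sum_add_distrib]
      congr 1
      exact Finset.sum_congr rfl fun k _ => by ring
    rw [h4]
    refine (norm_add_le _ _).trans_lt ?_
    linarith
  exact hclosed f (by rw [span_mFourier_closure_eq_top]; trivial)

/-- **Kronecker's density theorem** on the torus. -/
theorem denseRange_nsmul_unitAddTorus {d : Type*} [Fintype d] (x : UnitAddTorus d)
    (hx : ∀ n : d → ℤ, mFourier n x = 1 → n = 0) :
    DenseRange (fun k : ℕ => k • x) := by
  by_contra hd
  obtain ⟨p, hp⟩ : ∃ p, p ∉ closure (Set.range fun k : ℕ => k • x) := by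
    simpa [DenseRange, Dense] using hd
  let f : UnitAddTorus d → ℝ := fun s => Metric.infDist s (closure (Set.range fun k : ℕ => k • x))
  have hne : (closure (Set.range fun k : ℕ => k • x)).Nonempty :=
    (Set.range_nonempty _).closure
  have hfc : Continuous f := Metric.continuous_infDist_pt _
  have hf0 : ∀ k : ℕ, f (k • x) = 0 := fun k =>
    Metric.infDist_zero_of_mem (subset_closure ⟨k, rfl⟩)
  have hfp : 0 < f p := (isClosed_closure.notMem_iff_infDist_pos hne).1 hp
  have hfn : ∀ s, 0 ≤ f s := fun s => Metric.infDist_nonneg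
  have havg : ∀ y, Tendsto (fun N : ℕ => (N : ℝ)⁻¹ * ∑ k ∈ Finset.range N, f (y + k • x))
      atTop (𝓝 0) := by
    intro y
    have := tendsto_average_sub_average x hx y ⟨fun s => (f s : ℂ), by fun_prop⟩
    simp only [ContinuousMap.coe_mk, hf0, Complex.ofReal_zero, sub_zero] at this
    have hre := (Complex.continuous_re.tendsto 0).comp this
    refine hre.congr fun N => ?_
    rw [Function.comp_apply, ← Complex.ofReal_sum, ← Complex.ofReal_natCast, ← Complex.ofReal_inv,
      ← Complex.ofReal_mul, Complex.ofReal_re]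
  -- Finitely many translates of `f` have a sum bounded below by a positive constant, although its
  -- averages along the orbit tend to 0.
  obtain ⟨t, ht⟩ := isCompact_univ.elim_finite_subcover
    (fun y : UnitAddTorus d => {s | 0 < f (y + s)})
    (fun y => isOpen_lt continuous_const (by fun_prop))
    (fun s _ => Set.mem_iUnion.2 ⟨p - s, by simpa using hfp⟩)
  have hF : ∀ s, 0 < ∑ y ∈ t, f (y + s) := by
    intro s
    obtain ⟨y, hy, hys⟩ := Set.mem_iUnion₂.1 (ht (Set.mem_univ s))
    exact Finset.sum_pos' (fun y _ => hfn _) ⟨y, hy, hys⟩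
  obtain ⟨s₀, -, hs₀⟩ := isCompact_univ.exists_isMinOn (Set.univ_nonempty (α := UnitAddTorus d))
    (f := fun s => ∑ y ∈ t, f (y + s)) (by fun_prop)
  have hsum := tendsto_finsetSum t fun y _ => havg y
  rw [Finset.sum_const_zero] at hsum
  have hge : ∀ᶠ N : ℕ in atTop, ∑ y ∈ t, f (y + s₀) ≤
      ∑ y ∈ t, (N : ℝ)⁻¹ * ∑ k ∈ Finset.range N, f (y + k • x) := by
    filter_upwards [eventually_gt_atTop 0] with N hN
    have : (0 : ℝ) < N := by exact_mod_cast hN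
    rw [← Finset.mul_sum, Finset.sum_comm, le_inv_mul_iff₀ this, ← nsmul_eq_mul]
    calc N • ∑ y ∈ t, f (y + s₀) = (Finset.range N).card • ∑ y ∈ t, f (y + s₀) := by simp
      _ ≤ _ := Finset.card_nsmul_le_sum _ _ _ fun k _ => hs₀ (Set.mem_univ _)
  exact absurd (ge_of_tendsto hsum hge) (not_le.2 (hF s₀))

/-- If no nontrivial rational relation holds, the pairs `(c ^ m * b ^ n, c ^ m)` accumulate at
every `(z, 0)`. -/
theorem mem_closure_range_pow_mul_pow {b c : ℂ} {r : ℝ}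
    (hb : b = (r : ℂ) * Complex.I) (hr : 1 < r) (hc : ‖c‖ < 1)
    (hind : LinearIndependent ℚ
      (![1, Real.log ‖c‖ / Real.log ‖b‖, Complex.arg c / (2 * Real.pi)] : Fin 3 → ℝ)) (z : ℂ) :
    (z, (0 : ℂ)) ∈ closure (Set.range fun e : ℕ × ℕ => (c ^ e.1 * b ^ e.2, c ^ e.1)) := by
  have hnb : ‖b‖ = r := by
    rw [hb]; simp [abs_of_pos (zero_lt_one.trans hr)]
  rw [hnb] at hind
  have hL : 0 < Real.log r := Real.log_pos hr
  have hc0 : c ≠ 0 := by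
    rintro rfl
    exact hind.ne_zero 1 (by simp)
  have hlc : Real.log ‖c‖ < 0 := Real.log_neg (norm_pos_iff.2 hc0) hc
  set L := Real.log r
  -- Since `b ^ 4 = r ^ 4 > 0`, powers of `b ^ 4` change only the modulus; `4 * L` is the logarithm
  -- of `b ^ 4`.
  set α : ℝ := Real.log ‖c‖ / (4 * L) with hα
  set β : ℝ := Complex.arg c / (2 * Real.pi) with hβ
  have hα0 : α < 0 := div_neg_of_neg_of_pos hlc (by positivity)
  have hdense : DenseRange (fun k : ℕ => k • (![(α : UnitAddCircle), (β : UnitAddCircle)] :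
      UnitAddTorus (Fin 2))) := by
    refine denseRange_nsmul_unitAddTorus _ fun n hn => ?_
    have h1 : mFourier n (![(α : UnitAddCircle), (β : UnitAddCircle)] : UnitAddTorus (Fin 2)) =
        Complex.exp (2 * Real.pi * Complex.I * (n 0 * α + n 1 * β)) := by
      simp only [mFourier, ContinuousMap.coe_mk, Fin.prod_univ_two, Matrix.cons_val_zero,
        Matrix.cons_val_one, fourier_coe_apply, ← Complex.exp_add]
      congr 1
      push_cast
      ring
    rw [h1, Complex.exp_eq_one_iff] at hn
    obtain ⟨m, hm⟩ := hn
    have h2 : (n 0 : ℝ) * α + n 1 * β = m := by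
      have hpi : (2 * Real.pi * Complex.I : ℂ) ≠ 0 := Complex.two_pi_I_ne_zero
      have : ((n 0 : ℂ) * α + n 1 * β) = m := by
        apply mul_left_cancel₀ hpi
        rw [hm]; ring
      exact_mod_cast this
    have h3 := Fintype.linearIndependent_iff.1 hind ![-(m : ℚ), (n 0 : ℚ) / 4, (n 1 : ℚ)] (by
      simp only [Fin.sum_univ_three, Matrix.cons_val_zero, Matrix.cons_val_one, Matrix.cons_val,
        Rat.smul_def]
      push_cast
      have h4 : (n 0 : ℝ) / 4 * (Real.log ‖c‖ / L) = n 0 * α := by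
        rw [hα]; field_simp
      rw [h4]
      linarith)
    ext i
    fin_cases i
    · simpa using h3 1
    · simpa using h3 2
  have hclus : ∀ p : UnitAddTorus (Fin 2), MapClusterPt p atTop
      (fun k : ℕ => k • (![(α : UnitAddCircle), (β : UnitAddCircle)] : UnitAddTorus (Fin 2))) :=
    fun p => ((mapClusterPt_atTop_nsmul_tfae p _).out 2 0).1 (hdense p)
  have hexp : ∀ (k s : ℕ) (t : ℤ), c ^ k * b ^ (4 * s) =
      Complex.exp (((4 * L * (k * α + s) : ℝ) : ℂ) +
        ((2 * Real.pi * (k * β + t) : ℝ) : ℂ) * Complex.I) := by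
    intro k s t
    have h1 : c = Complex.exp (((4 * L * α : ℝ) : ℂ) + ((2 * Real.pi * β : ℝ) : ℂ) * Complex.I) := by
      have e1 : 4 * L * α = Real.log ‖c‖ := by rw [hα]; field_simp
      have e2 : 2 * Real.pi * β = Complex.arg c := by rw [hβ]; field_simp
      rw [e1, e2, Complex.exp_add, ← Complex.ofReal_exp, Real.exp_log (norm_pos_iff.2 hc0),
        Complex.norm_mul_exp_arg_mul_I]
    have h2 : b ^ 4 = Complex.exp ((4 * L : ℝ) : ℂ) := by
      have e3 : Real.exp (4 * L) = r ^ 4 := by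
        rw [show 4 * L = ((4 : ℕ) : ℝ) * L by norm_num, Real.exp_nat_mul,
          Real.exp_log (zero_lt_one.trans hr)]
      rw [← Complex.ofReal_exp, e3, hb, mul_pow, Complex.I_pow_four]
      push_cast
      ring
    rw [pow_mul, h2]
    nth_rewrite 1 [h1]
    rw [← Complex.exp_nat_mul, ← Complex.exp_nat_mul, ← Complex.exp_add,
      Complex.exp_eq_exp_iff_exists_int]
    refine ⟨-t, ?_⟩
    push_cast
    ring
  have hnz : ∀ z : ℂ, z ≠ 0 → (z, (0 : ℂ)) ∈
      closure (Set.range fun e : ℕ × ℕ => (c ^ e.1 * b ^ e.2, c ^ e.1)) := by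
    intro z hz
    set p : ℝ := Real.log ‖z‖ / (4 * L) with hp
    set q : ℝ := Complex.arg z / (2 * Real.pi) with hq
    let g : ℝ × ℝ → ℂ := fun w => Complex.exp (((4 * L * w.1 : ℝ) : ℂ) +
        ((2 * Real.pi * w.2 : ℝ) : ℂ) * Complex.I)
    have hg : Continuous g := by fun_prop
    have hgz : g (p, q) = z := by
      have e1 : 4 * L * p = Real.log ‖z‖ := by rw [hp]; field_simp
      have e2 : 2 * Real.pi * q = Complex.arg z := by rw [hq]; field_simp
      simp only [g]
      rw [e1, e2, Complex.exp_add, ← Complex.ofReal_exp, Real.exp_log (norm_pos_iff.2 hz),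
        Complex.norm_mul_exp_arg_mul_I]
    rw [Metric.mem_closure_iff]
    intro ε hε
    obtain ⟨δ, hδ, hgδ⟩ := Metric.continuous_iff.1 hg (p, q) ε hε
    have hfreq := mapClusterPt_iff_frequently.1 (hclus ![(p : UnitAddCircle), (q : UnitAddCircle)])
      _ (Metric.ball_mem_nhds _ hδ)
    have hev1 : ∀ᶠ k : ℕ in atTop, ‖c ^ k‖ < ε := by
      have := (tendsto_pow_atTop_nhds_zero_of_norm_lt_one hc).norm
      rw [norm_zero] at this
      exact this.eventually_lt_const hε
    -- This makes the integer correcting `k * α` nonnegative, hence a legitimate exponent of `b ^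
    -- 4`.
    have hev2 : ∀ᶠ k : ℕ in atTop, (k : ℝ) * α < p - δ :=
      (tendsto_natCast_atTop_atTop.atTop_mul_const_of_neg hα0).eventually_lt_atBot _
    obtain ⟨k, hk, hk1, hk2⟩ := (hfreq.and_eventually (hev1.and hev2)).exists
    rw [Metric.mem_ball, dist_pi_lt_iff hδ] at hk
    have hk3 : ‖((k * α - p : ℝ) : UnitAddCircle)‖ < δ := by
      simpa [dist_eq_norm] using hk 0
    have hk4 : ‖((k * β - q : ℝ) : UnitAddCircle)‖ < δ := by
      simpa [dist_eq_norm] using hk 1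
    rw [UnitAddCircle.norm_eq] at hk3 hk4
    have hs : 0 ≤ -round (k * α - p) := by
      have := (abs_lt.1 hk3).1
      have h5 : ((-1 : ℤ) : ℝ) < ((-round (k * α - p) : ℤ) : ℝ) := by
        push_cast
        linarith
      have := Int.cast_lt.1 h5
      omega
    obtain ⟨s, hs⟩ := Int.eq_ofNat_of_zero_le hs
    have hs' : (s : ℝ) = -(round (k * α - p) : ℝ) := by exact_mod_cast hs.symm
    refine ⟨_, ⟨(k, 4 * s), rfl⟩, ?_⟩
    rw [Prod.dist_eq, max_lt_iff]
    constructor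
    · have := hgδ (k * α + s, k * β + (-round (k * β - q) : ℤ)) (by
        rw [Prod.dist_eq, max_lt_iff, Real.dist_eq, Real.dist_eq]
        constructor
        · rw [hs']
          refine lt_of_eq_of_lt (congrArg _ ?_) hk3
          ring
        · push_cast
          refine lt_of_eq_of_lt (congrArg _ ?_) hk4
          ring)
      rw [hgz, dist_comm] at this
      simpa only [hexp k s (-round (k * β - q))] using this
    · simpa using hk1
  have hcl : IsClosed {z : ℂ | (z, (0 : ℂ)) ∈
      closure (Set.range fun e : ℕ × ℕ => (c ^ e.1 * b ^ e.2, c ^ e.1))} :=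
    isClosed_closure.preimage (by fun_prop : Continuous fun z : ℂ => (z, (0 : ℂ)))
  exact hcl.closure_subset_iff.2 (fun z hz => hnz z hz) (dense_compl_singleton (0 : ℂ) z)

theorem mainTheorem6 (a b c u : ℂ) (r : ℝ)
    (ha : a ≠ 0) (hu : u ≠ 0)
    (hb : b = (r : ℂ) * Complex.I) (hr : 1 < r) (hc : ‖c‖ < 1)
    (hind : LinearIndependent ℚ
      (![1, Real.log ‖c‖ / Real.log ‖b‖, Complex.arg c / (2 * Real.pi)] : Fin 3 → ℝ)) :
    Dense ((Subsemigroup.closure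
      {!![c, 0; 0, 1], !![1, 0; 0, b], !![u, a; 1, 0]} :
        Subsemigroup (Matrix (Fin 2) (Fin 2) ℂ)) : Set (Matrix (Fin 2) (Fin 2) ℂ)) := by
  set S : Subsemigroup (Matrix (Fin 2) (Fin 2) ℂ) := Subsemigroup.closure
      {!![c, 0; 0, 1], !![1, 0; 0, b], !![u, a; 1, 0]} with hS
  have hC : !![c, 0; 0, 1] ∈ S := Subsemigroup.subset_closure (by simp)
  have hB : !![1, 0; 0, b] ∈ S := Subsemigroup.subset_closure (by simp)
  have hA : !![u, a; 1, 0] ∈ S := Subsemigroup.subset_closure (by simp)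
  have hdiag : ∀ (m₁ n₁ m₂ n₂ : ℕ),
      !![c ^ m₁ * u * c ^ m₂, c ^ m₁ * b ^ n₂ * a; c ^ m₂ * b ^ n₁, 0] ∈ S := by
    intro m₁ n₁ m₂ n₂
    induction m₁ with
    | succ m ih => convert S.mul_mem hC ih using 1; simp [pow_succ']; constructor <;> ring
    | zero =>
    induction n₁ with
    | succ m ih => convert S.mul_mem hB ih using 1; simp [pow_succ']; ring
    | zero =>
    induction m₂ with
    | succ m ih => convert S.mul_mem ih hC using 1; simp [pow_succ]; ring
    | zero =>
    induction n₂ with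
    | succ m ih => convert S.mul_mem ih hB using 1; simp [pow_succ]; ring
    | zero => simpa using hA
  set T := S.topologicalClosure with hT
  have hST : ∀ M ∈ S, M ∈ T := fun M hM => subset_closure hM
  have hanti : ∀ z w : ℂ, !![0, z; w, 0] ∈ T := by
    intro z w
    have h := map_mem_closure₂ (f := fun p q : ℂ × ℂ => !![p.2 * u * q.2, p.1 * a; q.1, 0])
      (u := (S : Set (Matrix (Fin 2) (Fin 2) ℂ))) (by fun_prop)
      (mem_closure_range_pow_mul_pow hb hr hc hind (z / a))
      (mem_closure_range_pow_mul_pow hb hr hc hind w)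
      (by rintro _ ⟨⟨m₁, n₂⟩, rfl⟩ _ ⟨⟨m₂, n₁⟩, rfl⟩; exact hdiag m₁ n₁ m₂ n₂)
    have h' : !![0, z; w, 0] ∈ closure (S : Set (Matrix (Fin 2) (Fin 2) ℂ)) := by
      simpa [ha] using h
    exact h'
  have hd : ∀ z w : ℂ, !![z, 0; 0, w] ∈ T := by
    intro z w
    convert T.mul_mem (hanti z w) (hanti 1 1) using 1
    simp
  have hcorner : ∀ p q s : ℂ, !![p, q; s, 0] ∈ T := by
    intro p q s
    by_cases hp : p = 0
    · rw [hp]; exact hanti q s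
    -- The left factor fixes the first column of `A`, the right one then adjusts the entry `p * a /
    -- u`.
    · convert T.mul_mem (T.mul_mem (hd (p / u) s) (hST _ hA)) (hd 1 (q * u / (p * a))) using 1
      simp
      constructor <;> field_simp
  have hupper : ∀ p q s : ℂ, !![p, q; 0, s] ∈ T := by
    intro p q s
    convert T.mul_mem (hcorner q p s) (hanti 1 1) using 1
    simp
  have hlower : ∀ p q s : ℂ, !![p, 0; q, s] ∈ T := by
    intro p q s
    convert T.mul_mem (hanti 1 1) (hcorner q s p) using 1
    simp
  intro M
  change M ∈ T
  rw [Matrix.eta_fin_two M]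
  -- With a zero pivot, swapping the columns already leaves a lower triangular matrix; otherwise LU
  -- applies.
  by_cases h : M 0 0 = 0
  · rw [h]
    convert T.mul_mem (hlower (M 0 1) (M 1 1) (M 1 0)) (hanti 1 1) using 1
    simp
  · convert T.mul_mem (hlower 1 (M 1 0 / M 0 0) 1)
      (hupper (M 0 0) (M 0 1) (M 1 1 - M 1 0 / M 0 0 * M 0 1)) using 1
    simp [h]
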